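/- Let $\mathcal K_n$ be the family of convex bodies in $\mathbb E^n$, i.e. convex compact sets with nonempty interior, and $\mathcal K_n^s$ the subfamily of centrally symmetric ones. For $A,B\subset\mathbb E^n$ let $C(A,B)$ be the minimal number of translates of $B$ needed to cover $A$, and put $$H_n=\max\{C(K,\operatorname{int}K):K\in\mathcal K_n\},\qquad H_n^s=\max\{C(K,\operatorname{int}K):K\in\mathcal K_n^s\}.$$ For $L\in\mathcal K_n$ with volume $|L|$, the covering density of space by translates of $L$ is $$\theta(L)=\lim_{R\to\infty}\ \inf\Bigl\{\frac{|L|\,N}{(2R)^n}:\ [-R,R]^n\subset\bigcup_{j=1}^N(x_j+L)\text{ for some }x_1,\dots,x_N\in\mathbb E^n\Bigr\}.$$ **Proposition.** Let $n\ge3$. The function $f_n(x)=(1+x)^n(1-n\ln x)$ attains a minimum on the open interval $(0,1/n)$; let $$r_n=\min_{x\in(0,1/n)}f_n(x).$$ Then for every $K\in\mathcal K_n$ the limit defining $\theta(K)$ exists and $\theta(K)\le r_n$. Moreover $$H_n\le\binom{2n}{n}r_n\qquad\text{and}\qquad H_n^s\le 2^n r_n .$$ In particular, $H_9\le 2064332$,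 $H_{10}\le 8950599$, $H_{11}\le 38482394$, $H_{12}\le 164319569$, $H_{13}\le 697656132$, $H_{14}\le 2947865482$, and $H_7^s\le 3954$, $H_8^s\le 9370$, $H_9^s\le 21738$, $H_{10}^s\le 49608$, $H_{11}^s\le 111721$, $H_{12}^s\le 248895$, $H_{13}^s\le 549506$, $H_{14}^s\le 1203936$. -/

import Mathlib

open Set Filter Topology MeasureTheory
open scoped ENNReal

namespace ConvexCovering

/-- `n`-dimensional Euclidean space. -/
abbrev E (n : ℕ) : Type := EuclideanSpace ℝ (Fin n)

/-- `N` translates of `B` cover `A`. -/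
def CoveredByTranslates {n : ℕ} (A B : Set (E n)) (N : ℕ) : Prop :=
  ∃ t : Fin N → E n, A ⊆ ⋃ j, (fun x => t j + x) '' B

/-- The minimal number `C(A, B)` of translates of `B` needed to cover `A`
(it is `⊤` if no finite number suffices). -/
noncomputable def coveringNum {n : ℕ} (A B : Set (E n)) : ℕ∞ :=
  ⨅ (N : ℕ) (_ : CoveredByTranslates A B N), (N : ℕ∞)

/-- The family of convex bodies: convex compact sets with nonempty interior
(the inhabitants of Mathlib's `ConvexBody` are only required to be nonempty). -/
def bodies (n : ℕ) : Set (ConvexBody (E n)) :=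
  {K | (interior (K : Set (E n))).Nonempty}

/-- The convex bodies with a centre of symmetry `c`, not necessarily the origin. -/
def symmBodies (n : ℕ) : Set (ConvexBody (E n)) :=
  {K | K ∈ bodies n ∧ ∃ c : E n, ∀ x ∈ K, (2 : ℝ) • c - x ∈ K}

/-- `H_n`: the smallest number such that every `n`-dimensional convex body can be covered by that
many translates of its interior. -/
noncomputable def hadwigerNum (n : ℕ) : ℕ∞ :=
  ⨆ K ∈ bodies n, coveringNum (K : Set (E n)) (interior (K : Set (E n)))

/-- `H_n^s`: the same for centrally symmetric convex bodies. -/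
noncomputable def hadwigerNumSymm (n : ℕ) : ℕ∞ :=
  ⨆ K ∈ symmBodies n, coveringNum (K : Set (E n)) (interior (K : Set (E n)))

/-- The cube `[-R, R]^n`. -/
def cube (n : ℕ) (R : ℝ) : Set (E n) := {x | ∀ i, x i ∈ Icc (-R) R}

/-- The infimum of `|L| N / (2R)^n` over all coverings of the cube `[-R, R]^n` by finitely many
translates of `L`, where `N` is the number of translates. -/
noncomputable def cubeDensity {n : ℕ} (L : Set (E n)) (R : ℝ) : ℝ :=
  sInf {d | ∃ N : ℕ, CoveredByTranslates (cube n R) L N ∧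
    d = volume.real L * (N : ℝ) / (2 * R) ^ n}

/-- The covering density of space by translates of `L`. -/
noncomputable def coveringDensity {n : ℕ} (L : Set (E n)) : ℝ :=
  limUnder atTop (fun R : ℝ => cubeDensity L R)

/-- `f_n(x) = (1 + x)^n (1 - n ln x)`. -/
noncomputable def rogersFun (n : ℕ) (x : ℝ) : ℝ :=
  (1 + x) ^ n * (1 - (n : ℝ) * Real.log x)

/-- `r_n`: the infimum of `f_n` over the interval `(0, 1/n)`. -/
noncomputable def rogersConst (n : ℕ) : ℝ :=
  sInf (rogersFun n '' Ioo 0 (1 / (n : ℝ)))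

end ConvexCovering

/-! The core is Rogers' two-stage covering of a large cube. Helly's theorem places the body so that
`-K ⊆ n K`. Averaging over translates shows that a greedy choice of `N` copies leaves a fraction of
at most `exp (-N δ)` uncovered, where `δ` is the ratio of the volume of `K` to that of a slightly
larger cube. A maximal packing of copies of `-η K` in the uncovered set `U` has few members.
Enlarging all chosen copies by `1 + η`, with `η ≤ 1 / n`, then covers everything: if `z - η K`
leaves `U`, it meets an old copy or lies partly outside the cube, which the margin excludes;
otherwise it meets a packed one. Stopping when the fraction is `η ^ n` gives density `(1 + η) ^ n *
(1 - n * log η)` (`exists_covering_enlarged`, `exists_covering_cube`).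

A covering of a large cube by `L` yields one of a compact `A`: a random position of `A` meets on
average about (density) `* |L - A| / |L|` of its members (`CoveredByTranslates.exists_shift`). With
`A = K`, `L = l K` and `l → 1` this bounds `C(K, int K)` by `r_n * |K - K| / |K|`. The volume ratio
is `2 ^ n` for symmetric `K` and at most `(2n).choose n` in general, by Rogers-Shephard
(`volume_sub_self_le`).

The minimum `r_n` is attained because `f_n` blows up at `0` and increases at `1 / n` once `log n >
1`. The numerical bounds come from evaluating `f_n` at explicit rationals. -/

namespace ConvexCovering

/-! ### Calculus of coverings by translates -/

section Translates
variable {n : ℕ}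

theorem coveredByTranslates_of_finite {ι : Type*} [Finite ι] {A B : Set (E n)} (t : ι → E n)
    (h : ∀ a ∈ A, ∃ i, ∃ b ∈ B, t i + b = a) : CoveredByTranslates A B (Nat.card ι) := by
  refine ⟨fun j => t ((Finite.equivFin ι).symm j), fun a ha => ?_⟩
  obtain ⟨i, b, hb, rfl⟩ := h a ha
  exact mem_iUnion.2 ⟨Finite.equivFin ι i, b, hb, by simp⟩

theorem CoveredByTranslates.exists_mem {A B : Set (E n)} {N : ℕ} (h : CoveredByTranslates A B N) :
    ∃ t : Fin N → E n, ∀ a ∈ A, ∃ i, ∃ b ∈ B, t i + b = a := by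
  obtain ⟨t, ht⟩ := h
  refine ⟨t, fun a ha => ?_⟩
  obtain ⟨i, b, hb, e⟩ := mem_iUnion.1 (ht ha)
  exact ⟨i, b, hb, e⟩

theorem CoveredByTranslates.mono {A A' B B' : Set (E n)} {N : ℕ} (h : CoveredByTranslates A B N)
    (hA : A' ⊆ A) (hB : B ⊆ B') : CoveredByTranslates A' B' N := by
  obtain ⟨t, ht⟩ := h.exists_mem
  have := coveredByTranslates_of_finite (A := A') (B := B') t fun a ha => by
    obtain ⟨i, b, hb, e⟩ := ht a (hA ha)
    exact ⟨i, b, hB hb, e⟩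
  simpa using this

theorem CoveredByTranslates.trans {A B C : Set (E n)} {N M : ℕ} (h : CoveredByTranslates A B N)
    (h' : CoveredByTranslates B C M) : CoveredByTranslates A C (N * M) := by
  obtain ⟨t, ht⟩ := h.exists_mem
  obtain ⟨s, hs⟩ := h'.exists_mem
  have := coveredByTranslates_of_finite (A := A) (B := C) (ι := Fin N × Fin M)
    (fun p => t p.1 + s p.2) fun a ha => by
    obtain ⟨i, b, hb, rfl⟩ := ht a ha
    obtain ⟨j, c, hc, rfl⟩ := hs b hb
    exact ⟨(i, j), c, hc, by simp [add_assoc]⟩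
  simpa using this

/-- Covering by translates does not see a translation of the covering body. -/
theorem CoveredByTranslates.of_translate {A B B' : Set (E n)} {N : ℕ}
    (h : CoveredByTranslates A B N) (v : E n) (hB : ∀ b ∈ B, b + v ∈ B') :
    CoveredByTranslates A B' N := by
  obtain ⟨t, ht⟩ := h.exists_mem
  have := coveredByTranslates_of_finite (A := A) (B := B') (fun i => t i - v) fun a ha => by
    obtain ⟨i, b, hb, e⟩ := ht a ha
    exact ⟨i, b + v, hB b hb, by rw [← e]; abel⟩
  simpa using this

end Translates

/-! ### Volume and tilings of cubes -/

section Cube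
variable {n : ℕ}

theorem cube_eq_preimage (R : ℝ) :
    cube n R = (WithLp.ofLp : E n → Fin n → ℝ) ⁻¹' Set.pi univ fun _ => Icc (-R) R := by
  ext x; simp only [cube, mem_ofPred_eq, mem_preimage, mem_univ_pi]

theorem isClosed_cube (R : ℝ) : IsClosed (cube n R) := by
  rw [cube_eq_preimage]
  exact (isClosed_set_pi fun _ _ => isClosed_Icc).preimage (PiLp.continuous_ofLp 2 _)

theorem measurableSet_cube (R : ℝ) : MeasurableSet (cube n R) := (isClosed_cube R).measurableSet

theorem volume_cube {R : ℝ} (hR : 0 ≤ R) : volume (cube n R) = ENNReal.ofReal ((2 * R) ^ n) := by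
  rw [cube_eq_preimage, (PiLp.volume_preserving_ofLp (Fin n)).measure_preimage
    (MeasurableSet.univ_pi fun _ => measurableSet_Icc).nullMeasurableSet, volume_pi_pi]
  simp only [Real.volume_Icc, Finset.prod_const, Finset.card_univ, Fintype.card_fin]
  rw [← ENNReal.ofReal_pow (by linarith)]
  ring_nf

theorem volume_real_cube {R : ℝ} (hR : 0 ≤ R) : volume.real (cube n R) = (2 * R) ^ n := by
  rw [measureReal_def, volume_cube hR, ENNReal.toReal_ofReal (by positivity)]

theorem volume_cube_ne_top {R : ℝ} (hR : 0 ≤ R) : volume (cube n R) ≠ ⊤ := by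
  simp [volume_cube hR]

theorem add_mem_cube {R S : ℝ} {x y : E n} (hx : x ∈ cube n R) (hy : y ∈ cube n S) :
    x + y ∈ cube n (R + S) := fun i => by
  have := hx i; have := hy i
  simp only [mem_Icc, PiLp.add_apply] at *
  constructor <;> linarith

theorem neg_mem_cube {R : ℝ} {x : E n} (hx : x ∈ cube n R) : -x ∈ cube n R := fun i => by
  have := hx i
  simp only [mem_Icc, PiLp.neg_apply] at *
  constructor <;> linarith

theorem sub_mem_cube {R S : ℝ} {x y : E n} (hx : x ∈ cube n R) (hy : y ∈ cube n S) :
    x - y ∈ cube n (R + S) := by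
  rw [sub_eq_add_neg]; exact add_mem_cube hx (neg_mem_cube hy)

theorem cube_mono {R S : ℝ} (h : R ≤ S) : cube n R ⊆ cube n S := fun x hx i => by
  have := hx i
  simp only [mem_Icc] at *
  constructor <;> linarith

theorem exists_subset_cube {K : Set (E n)} (hK : Bornology.IsBounded K) :
    ∃ c : ℝ, 0 < c ∧ K ⊆ cube n c := by
  obtain ⟨c, hc, h⟩ := hK.exists_pos_norm_le
  refine ⟨c, hc, fun x hx i => ?_⟩
  have : |x i| ≤ c := (PiLp.norm_apply_le x i).trans (h x hx)
  exact abs_le.1 this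

/-- A cube is tiled by smaller ones. -/
theorem coveredByTranslates_cube_cube {R : ℝ} (hR : 0 < R) {m : ℕ} (hm : 1 ≤ m) :
    CoveredByTranslates (cube n (m * R)) (cube n R) (m ^ n) := by
  have key : ∀ x ∈ Icc (-(m * R)) (m * R), ∃ k : Fin m, |x - (-(m * R) + R + 2 * R * (k : ℕ))| ≤ R := by
    intro x hx
    set u := (x + m * R) / (2 * R) with hu
    have hxu : x = 2 * R * u - m * R := by rw [hu]; field_simp; ring
    have hu0 : 0 ≤ u := div_nonneg (by linarith [hx.1]) (by linarith)
    have hum : u ≤ m := by rw [hu, div_le_iff₀ (by linarith)]; linarith [hx.2]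
    have hk : ⌈u⌉₊ ≤ m := Nat.ceil_le.2 hum
    -- The ceiling minus one keeps the right end `u = m` in the last cell; truncated subtraction
    -- puts `u = 0` in the first.
    refine ⟨⟨⌈u⌉₊ - 1, by omega⟩, ?_⟩
    have h1 : ((⌈u⌉₊ - 1 : ℕ) : ℝ) ≤ u := by
      rcases Nat.eq_zero_or_pos ⌈u⌉₊ with h | h
      · simpa [h] using hu0
      · rw [Nat.cast_sub h]; have := Nat.ceil_lt_add_one hu0; push_cast; linarith
    have h2 : u ≤ ((⌈u⌉₊ - 1 : ℕ) : ℝ) + 1 := by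
      have : (⌈u⌉₊ : ℝ) ≤ ((⌈u⌉₊ - 1 : ℕ) : ℝ) + 1 := by
        exact_mod_cast (by omega : ⌈u⌉₊ ≤ ⌈u⌉₊ - 1 + 1)
      linarith [Nat.le_ceil u]
    simp only [abs_le]
    constructor <;> nlinarith
  have := coveredByTranslates_of_finite (n := n) (A := cube n (m * R)) (B := cube n R)
    (ι := Fin n → Fin m) (fun k => WithLp.toLp 2 fun i => -(m * R) + R + 2 * R * (k i : ℕ)) fun x hx => by
    choose k hk using fun i => key (x i) (hx i)
    refine ⟨k, x - WithLp.toLp 2 fun i => -(m * R) + R + 2 * R * (k i : ℕ), fun i => ?_, by abel⟩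
    simpa [abs_le] using hk i
  simpa using this

end Cube

/-! ### Greedy covering and maximal packings -/

section Greedy
variable {V : Type*} [NormedAddCommGroup V] [InnerProductSpace ℝ V] [FiniteDimensional ℝ V]
  [MeasurableSpace V] [BorelSpace V]

theorem measurableSet_prod_sub {U K : Set V} (hU : MeasurableSet U) (hK : MeasurableSet K) :
    MeasurableSet {p : V × V | p.2 ∈ U ∧ p.2 - p.1 ∈ K} :=
  (measurable_snd hU).inter ((measurable_snd.sub measurable_fst) hK)

/-- Fubini for the pairs `(x, z)` with `z ∈ U ∩ (x + K)`. It drives both the greedy covering and the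
Rogers-Shephard inequality. -/
theorem lintegral_volume_inter_translate {U K : Set V} (hU : MeasurableSet U)
    (hK : MeasurableSet K) :
    ∫⁻ x, volume {z | z ∈ U ∧ z - x ∈ K} = volume U * volume K := by
  have h := measurableSet_prod_sub hU hK
  have h1 := Measure.prod_apply (μ := (volume : Measure V)) (ν := (volume : Measure V)) h
  have h2 := Measure.prod_apply_symm (μ := (volume : Measure V)) (ν := (volume : Measure V)) h
  have h3 : ∀ z : V, volume ((fun x => (x, z)) ⁻¹' {p : V × V | p.2 ∈ U ∧ p.2 - p.1 ∈ K})
      = U.indicator (fun _ => volume K) z := by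
    intro z
    by_cases hz : z ∈ U
    · have : (fun x => (x, z)) ⁻¹' {p : V × V | p.2 ∈ U ∧ p.2 - p.1 ∈ K} = (fun x => z - x) ⁻¹' K := by
        ext x; simp [hz]
      rw [this, indicator_of_mem hz, (Measure.measurePreserving_sub_left volume z).measure_preimage
        hK.nullMeasurableSet]
    · have : (fun x => (x, z)) ⁻¹' {p : V × V | p.2 ∈ U ∧ p.2 - p.1 ∈ K} = ∅ := by
        ext x; simp [hz]
      rw [this, indicator_of_notMem hz, measure_empty]
  rw [lintegral_congr h3, lintegral_indicator hU, setLIntegral_const, mul_comm] at h2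
  rw [← h2, h1]
  rfl

/-- A translate `x + K` meets `U` only if `x ∈ Q`, so the whole Fubini integral lives on `Q`, and
some `x` does at least as well as the average there. -/
theorem exists_translate_volume_inter_ge {U K Q : Set V} (hU : MeasurableSet U)
    (hK : MeasurableSet K) (hQ : MeasurableSet Q) (hU' : volume U ≠ ⊤) (hK' : volume K ≠ ⊤)
    (hQ0 : volume Q ≠ 0) (hQt : volume Q ≠ ⊤) (h : ∀ z ∈ U, ∀ k ∈ K, z - k ∈ Q) :
    ∃ x, volume U * volume K ≤ volume {z | z ∈ U ∧ z - x ∈ K} * volume Q := by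
  have hint : ∫⁻ x in Q, volume {z | z ∈ U ∧ z - x ∈ K} = volume U * volume K := by
    rw [← lintegral_volume_inter_translate hU hK]
    rw [← lintegral_indicator hQ]
    refine lintegral_congr fun x => ?_
    by_cases hx : x ∈ Q
    · rw [indicator_of_mem hx]
    · have : {z | z ∈ U ∧ z - x ∈ K} = ∅ := eq_empty_of_forall_notMem fun z hz =>
        hx (by simpa using h z hz.1 _ hz.2)
      rw [indicator_of_notMem hx, this, measure_empty]
  obtain ⟨x, -, hx⟩ := exists_setLAverage_le hQ0 hQ.nullMeasurableSet
    (f := fun x => volume {z | z ∈ U ∧ z - x ∈ K}) (by rw [hint]; exact ENNReal.mul_ne_top hU' hK')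
  refine ⟨x, ?_⟩
  rwa [setLAverage_eq, hint, ENNReal.div_le_iff hQ0 hQt] at hx

/-- Each greedy step shrinks the uncovered volume by a factor of at most `1 - δ ≤ exp (-δ)`, where
`δ = |K| / |Q|`. -/
theorem exists_translates_volume_diff_le {U K Q : Set V} (hU : MeasurableSet U)
    (hK : MeasurableSet K) (hQ : MeasurableSet Q) (hU' : volume U ≠ ⊤) (hK' : volume K ≠ ⊤)
    (hQ0 : volume Q ≠ 0) (hQt : volume Q ≠ ⊤) (h : ∀ z ∈ U, ∀ k ∈ K, z - k ∈ Q) (N : ℕ) :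
    ∃ t : Fin N → V, volume.real {z | z ∈ U ∧ ∀ i, z - t i ∉ K} ≤
      Real.exp (-(N * (volume.real K / volume.real Q))) * volume.real U := by
  induction N with
  | zero =>
    refine ⟨fun i => i.elim0, ?_⟩
    simp
  | succ N ih =>
    obtain ⟨t, ht⟩ := ih
    set W := {z | z ∈ U ∧ ∀ i, z - t i ∉ K} with hW
    have hWU : W ⊆ U := fun z hz => hz.1
    have hWm : MeasurableSet W := by
      have : W = U ∩ ⋂ i, (fun z => z - t i) ⁻¹' Kᶜ := by ext z; simp [hW]
      rw [this]
      exact hU.inter (MeasurableSet.iInter fun i => (measurable_id.sub_const (t i)) hK.compl)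
    have hWt : volume W ≠ ⊤ := measure_ne_top_of_subset hWU hU'
    obtain ⟨x, hx⟩ := exists_translate_volume_inter_ge hWm hK hQ hWt hK' hQ0 hQt
      fun z hz => h z (hWU hz)
    refine ⟨Fin.snoc t x, ?_⟩
    have hset : {z | z ∈ U ∧ ∀ i, z - (Fin.snoc t x : Fin (N + 1) → V) i ∉ K}
        = W \ {z | z ∈ W ∧ z - x ∈ K} := by
      ext z
      simp only [hW, mem_ofPred_eq, Fin.forall_fin_succ', Fin.snoc_castSucc, Fin.snoc_last, Set.mem_sdiff]
      tauto
    have hsub : {z | z ∈ W ∧ z - x ∈ K} ⊆ W := fun z hz => hz.1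
    have hm : MeasurableSet {z | z ∈ W ∧ z - x ∈ K} :=
      hWm.inter ((measurable_id.sub_const x) hK)
    have hQpos : 0 < volume.real Q := ENNReal.toReal_pos hQ0 hQt
    have hx' : volume.real W * volume.real K ≤ volume.real {z | z ∈ W ∧ z - x ∈ K} * volume.real Q := by
      simp only [measureReal_def, ← ENNReal.toReal_mul]
      exact ENNReal.toReal_mono (ENNReal.mul_ne_top (measure_ne_top_of_subset hsub hWt) hQt) hx
    rw [hset, measureReal_sdiff hsub hm hWt]
    set δ := volume.real K / volume.real Q with hδ
    have h1 : volume.real W * δ ≤ volume.real {z | z ∈ W ∧ z - x ∈ K} := by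
      rw [hδ, ← mul_div_assoc, div_le_iff₀ hQpos]; exact hx'
    have h2 : 1 - δ ≤ Real.exp (-δ) := by linarith [Real.add_one_le_exp (-δ)]
    have h3 : Real.exp (-((N + 1 : ℕ) * δ)) = Real.exp (-δ) * Real.exp (-(N * δ)) := by
      rw [← Real.exp_add]; congr 1; push_cast; ring
    rw [h3]
    calc _ ≤ (1 - δ) * volume.real W := by linarith
      _ ≤ Real.exp (-δ) * volume.real W := by gcongr
      _ ≤ _ := by rw [mul_assoc]; gcongr

/-- A maximal packing of translates of `B` in `U`. -/
theorem exists_maximal_packing {U B : Set V} (hB : MeasurableSet B)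
    (hU' : volume U ≠ ⊤) (hB0 : volume B ≠ 0) (hBt : volume B ≠ ⊤) :
    ∃ s : Finset V, s.card * volume.real B ≤ volume.real U ∧
      ∀ z, (∀ b ∈ B, z + b ∈ U) → ∃ y ∈ s, ∃ b ∈ B, ∃ b' ∈ B, z + b = y + b' := by
  classical
  let P : Finset V → Prop := fun s => (∀ y ∈ s, ∀ b ∈ B, y + b ∈ U) ∧
    (s : Set V).PairwiseDisjoint fun y => (fun z => z - y) ⁻¹' B
  have hBpos : 0 < volume.real B := ENNReal.toReal_pos hB0 hBt
  have hcard : ∀ s, P s → s.card * volume.real B ≤ volume.real U := by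
    intro s hs
    have hm : ∀ y ∈ s, MeasurableSet ((fun z => z - y) ⁻¹' B) := fun y _ =>
      (measurable_id.sub_const y) hB
    have h1 : volume (⋃ y ∈ s, (fun z => z - y) ⁻¹' B) ≤ volume U := by
      refine measure_mono (iUnion₂_subset fun y hy z hz => ?_)
      simpa using hs.1 y hy _ hz
    rw [measure_biUnion_finset hs.2 hm] at h1
    simp only [sub_eq_add_neg, measure_preimage_add_right, Finset.sum_const, nsmul_eq_mul] at h1
    have := ENNReal.toReal_mono hU' h1
    simpa [measureReal_def] using this
  -- Packings have bounded cardinality, so a largest one exists. A `z` whose copy misses all the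
  -- others could be added to it.
  let cards : Set ℕ := {k | ∃ s, P s ∧ s.card = k}
  have hbdd : BddAbove cards := by
    refine ⟨⌊volume.real U / volume.real B⌋₊, ?_⟩
    rintro _ ⟨s, hs, rfl⟩
    exact Nat.le_floor ((le_div_iff₀ hBpos).2 (hcard s hs))
  have hne : cards.Nonempty := ⟨0, ∅, ⟨by simp, by simp⟩, rfl⟩
  obtain ⟨s, hs, hsc⟩ := Nat.sSup_mem hne hbdd
  refine ⟨s, hcard s hs, fun z hz => ?_⟩
  by_contra hcon
  push Not at hcon
  obtain ⟨b₀, hb₀⟩ : B.Nonempty := nonempty_of_measure_ne_zero hB0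
  have hzs : z ∉ s := fun h => hcon z h b₀ hb₀ b₀ hb₀ rfl
  have hP : P (insert z s) := by
    refine ⟨fun y hy => ?_, ?_⟩
    · rcases Finset.mem_insert.1 hy with rfl | hy
      · exact hz
      · exact hs.1 y hy
    · rw [Finset.coe_insert]
      refine hs.2.insert fun y hy _ => ?_
      refine Set.disjoint_left.2 fun w hw hw' => ?_
      exact hcon y hy _ hw _ hw' (by simp)
  have := le_csSup hbdd ⟨_, hP, rfl⟩
  rw [Finset.card_insert_of_notMem hzs, hsc] at this
  omega

end Greedy

/-! ### Helly's theorem and the reflected body -/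

section Helly
open scoped Pointwise

/-- A compact convex set contains, up to translation, its reflection shrunk by the dimension. -/
theorem exists_reflection_subset {n : ℕ} (hn : 1 ≤ n) {K : Set (E n)} (hc : Convex ℝ K)
    (hK : IsCompact K) (hi : (interior K).Nonempty) :
    ∃ c : E n, ∀ x ∈ K, ∃ y ∈ K, x + (n : ℝ) • y = ((n : ℝ) + 1) • c := by
  have : NeZero n := ⟨by omega⟩
  have hn0 : (n : ℝ) ≠ 0 := by positivity
  have hn1 : (n : ℝ) + 1 ≠ 0 := by positivity
  -- This form of Helly's theorem tests subfamilies of exactly `n + 1` members, so the index set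
  -- must have that many.
  have hinf : Infinite K := by
    obtain ⟨x, hx⟩ := hi
    exact (infinite_of_mem_nhds x (mem_interior_iff_mem_nhds.1 hx)).to_subtype
  let F : K → Set (E n) := fun x =>
    (fun y => ((n : ℝ) + 1)⁻¹ • ((x : E n) + (n : ℝ) • y)) '' K
  have key : (⋂ i, F i).Nonempty := by
    refine Convex.helly_theorem_compact (𝕜 := ℝ) (by simp) (fun x => ?_) (fun x => ?_) fun I hI => ?_
    · have : F x = ((n : ℝ) + 1)⁻¹ • ((fun z => (x : E n) + z) '' ((n : ℝ) • K)) := by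
        rw [← image_smul, ← image_smul, image_image, image_image]
      rw [this]
      exact (((hc.smul _).translate _)).smul _
    · exact hK.image (by fun_prop)
    · classical
      simp only [finrank_euclideanSpace, Fintype.card_fin] at hI
      -- The centroid of the `n + 1` chosen points works: for each `x`, the mean of the other `n`
      -- points is the required `y ∈ K`.
      refine ⟨((n : ℝ) + 1)⁻¹ • ∑ x ∈ I, (x : E n), mem_iInter₂.2 fun x hx => ?_⟩
      refine ⟨∑ y ∈ I.erase x, (n : ℝ)⁻¹ • (y : E n), ?_, ?_⟩
      · refine hc.sum_mem (fun _ _ => by positivity) ?_ fun y _ => y.2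
        rw [Finset.sum_const, Finset.card_erase_of_mem hx, hI]
        simp [hn0]
      · dsimp only
        rw [← Finset.smul_sum, smul_smul, mul_inv_cancel₀ hn0, one_smul,
          Finset.add_sum_erase I (fun y : K => (y : E n)) hx]
  obtain ⟨c, hc⟩ := key
  refine ⟨c, fun x hx => ?_⟩
  obtain ⟨y, hy, e⟩ := mem_iInter.1 hc ⟨x, hx⟩
  exact ⟨y, hy, by rw [← e]; simp [smul_smul, hn1]⟩

end Helly

/-! ### Rogers' covering of a cube -/

section Covering
open scoped Pointwise
variable {n : ℕ}

/-- Here `N` counts greedy copies and `M` packed ones. The margins `c` and `2 * c` keep every `z - η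
K` inside the cube where the greedy stage works, and every useful translation vector inside the cube
averaged over. -/
theorem exists_covering_enlarged (hn : 1 ≤ n) {K : Set (E n)} (hc : Convex ℝ K)
    (hK : IsCompact K) (hv : 0 < volume.real K)
    (hr : ∀ x ∈ K, ∃ y ∈ K, x + (n : ℝ) • y = 0) {η : ℝ} (h0 : 0 < η) (h1 : η ≤ 1 / n)
    {c : ℝ} (hc0 : 0 < c) (hKc : K ⊆ cube n c) {R : ℝ} (hR : 0 < R) (N : ℕ) :
    ∃ M : ℕ, CoveredByTranslates (cube n R) ((1 + η) • K) (N + M) ∧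
      M * (η ^ n * volume.real K) ≤
        Real.exp (-(N * (volume.real K / (2 * (R + 2 * c)) ^ n))) * (2 * (R + c)) ^ n := by
  have hn' : (1 : ℝ) ≤ n := by exact_mod_cast hn
  have hηn : η * n ≤ 1 := by rwa [le_div_iff₀ (by linarith)] at h1
  have hη1 : η ≤ 1 := by nlinarith
  have hKt : volume K ≠ ⊤ := hK.measure_lt_top.ne
  have hKm : MeasurableSet K := hK.measurableSet
  have hQ0 : volume (cube n (R + 2 * c)) ≠ 0 := by
    rw [volume_cube (by linarith)]
    simp only [ne_eq, ENNReal.ofReal_eq_zero, not_le]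
    positivity
  obtain ⟨t, ht⟩ := exists_translates_volume_diff_le (measurableSet_cube (R + c)) hKm
    (measurableSet_cube (R + 2 * c)) (volume_cube_ne_top (by linarith)) hKt hQ0
    (volume_cube_ne_top (by linarith))
    (fun z hz k hk => by
      have := sub_mem_cube hz (hKc hk)
      rwa [show R + c + c = R + 2 * c by ring] at this) N
  rw [volume_real_cube (by linarith), volume_real_cube (by linarith)] at ht
  set U := {z | z ∈ cube n (R + c) ∧ ∀ i, z - t i ∉ K} with hU
  have hUt : volume U ≠ ⊤ :=
    measure_ne_top_of_subset (fun z hz => hz.1) (volume_cube_ne_top (n := n) (R := R + c) (by linarith))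
  set B : Set (E n) := (-η) • K with hB
  have hvB : volume.real B = η ^ n * volume.real K := by
    rw [hB, measureReal_def, Measure.addHaar_smul, ENNReal.toReal_mul,
      ENNReal.toReal_ofReal (abs_nonneg _), finrank_euclideanSpace, Fintype.card_fin, abs_pow,
      abs_neg, abs_of_pos h0, measureReal_def]
  have hBc : IsCompact B := hK.smul _
  have hB0 : volume B ≠ 0 := fun h => by
    have : volume.real B = 0 := by simp [measureReal_def, h]
    rw [hvB] at this
    have : 0 < η ^ n * volume.real K := by positivity
    linarith
  obtain ⟨s, hs, hmax⟩ := exists_maximal_packing hBc.measurableSet hUt hB0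
    hBc.measure_lt_top.ne
  refine ⟨s.card, ?_, by rw [← hvB]; exact hs.trans ht⟩
  obtain ⟨x₀, hx₀⟩ : K.Nonempty := by
    rw [nonempty_iff_ne_empty]; rintro rfl; simp at hv
  have hK0 : (0 : E n) ∈ K := by
    obtain ⟨y, hy, e⟩ := hr x₀ hx₀
    have := hc hx₀ hy (a := 1 / (n + 1)) (b := n / (n + 1)) (by positivity) (by positivity)
      (by field_simp; ring)
    have e2 : (1 / ((n : ℝ) + 1)) • x₀ + ((n : ℝ) / (n + 1)) • y = (1 / ((n : ℝ) + 1)) • (x₀ + (n : ℝ) • y) := by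
      rw [smul_add, smul_smul]; congr 2; ring
    rwa [e2, e, smul_zero] at this
  have := coveredByTranslates_of_finite (A := cube n R) (B := (1 + η) • K) (ι := Fin N ⊕ s)
    (Sum.elim t fun y => (y : E n)) fun z hz => by
    -- If `z + B` lies in `U`, maximality makes it meet some `y + B`; otherwise a point of `z + B`
    -- lies in a greedy copy.
    by_cases hzU : ∀ b ∈ B, z + b ∈ U
    · obtain ⟨y, hy, b, hb, b', hb', e⟩ := hmax z hzU
      obtain ⟨k, hk, rfl⟩ := hb
      obtain ⟨k', hk', rfl⟩ := hb'
      obtain ⟨w, hw, ew⟩ := hr k' hk'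
      refine ⟨Sum.inr ⟨y, hy⟩, η • k + (η * n) • w, ?_, ?_⟩
      -- Here `z - y = η k - η k'` and `-k' = n w`. The remaining share `1 - η n` of `K` contributes
      -- `0`; this is where `η ≤ 1 / n` is needed.
      · have e1 : 1 + η = η + η * n + (1 - η * n) := by ring
        rw [e1, hc.add_smul (by positivity) (by linarith), hc.add_smul h0.le (by positivity)]
        exact ⟨_, ⟨_, ⟨k, hk, rfl⟩, _, ⟨w, hw, rfl⟩, rfl⟩, _, ⟨0, hK0, rfl⟩, by simp⟩
      · have e2 : k' = -((n : ℝ) • w) := eq_neg_of_add_eq_zero_left ew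
        have e3 : z = y + (-η) • k' + η • k := by
          rw [← e]; simp
        simp only [Sum.elim_inr]
        rw [e3, e2, mul_smul]
        simp only [neg_smul, smul_neg, neg_neg]
        abel
    · push Not at hzU
      obtain ⟨b, hb, hzb⟩ := hzU
      have hbc : b ∈ cube n c := by
        obtain ⟨k, hk, rfl⟩ := hb
        intro i
        have := hKc hk i
        simp only [mem_Icc, PiLp.smul_apply, smul_eq_mul] at *
        constructor <;> nlinarith
      have hz' := add_mem_cube hz hbc
      have : ∃ i, z + b - t i ∈ K := by
        by_contra hcon
        push Not at hcon
        exact hzb ⟨hz', hcon⟩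
      obtain ⟨i, hi⟩ := this
      obtain ⟨k, hk, rfl⟩ := hb
      refine ⟨Sum.inl i, (z + (-η) • k - t i) + η • k, ?_, ?_⟩
      · rw [hc.add_smul zero_le_one h0.le, one_smul]
        exact ⟨_, hi, _, ⟨k, hk, rfl⟩, rfl⟩
      · simp only [neg_smul, Sum.elim_inl]
        abel
  simpa using this

/-- **Rogers' covering bound** for cubes. -/
theorem exists_covering_cube (hn : 1 ≤ n) {K : Set (E n)} (hc : Convex ℝ K) (hK : IsCompact K)
    (hi : (interior K).Nonempty) {η : ℝ} (h0 : 0 < η) (h1 : η ≤ 1 / n) :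
    ∃ c C : ℝ, ∀ R : ℝ, 0 < R → ∃ N : ℕ, CoveredByTranslates (cube n R) K N ∧
      N * volume.real K ≤ rogersFun n η * (2 * (R + c)) ^ n + C := by
  obtain ⟨p, hp⟩ := exists_reflection_subset hn hc hK hi
  have hn' : (1 : ℝ) ≤ n := by exact_mod_cast hn
  have hη1 : η ≤ 1 := h1.trans (by rw [div_le_one (by linarith)]; exact hn')
  have h1η : 0 < 1 + η := by linarith
  -- Shrunk beforehand, so that the enlarged copies are translates of `K`.
  set L : Set (E n) := (1 + η)⁻¹ • ((fun x => -p + x) '' K) with hL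
  have hLc : IsCompact L := (hK.image (by fun_prop)).smul _
  have hLconv : Convex ℝ L := (hc.translate _).smul _
  have hLv : volume.real L = ((1 + η) ^ n)⁻¹ * volume.real K := by
    rw [hL, measureReal_def, Measure.addHaar_smul, ENNReal.toReal_mul,
      ENNReal.toReal_ofReal (abs_nonneg _), finrank_euclideanSpace, Fintype.card_fin,
      image_add_left, measure_preimage_add, abs_of_pos (by positivity), inv_pow, measureReal_def]
  have hKv : 0 < volume.real K :=
    ENNReal.toReal_pos (Measure.measure_pos_of_nonempty_interior _ hi).ne' hK.measure_lt_top.ne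
  have hLpos : 0 < volume.real L := by rw [hLv]; positivity
  have hLr : ∀ x ∈ L, ∃ y ∈ L, x + (n : ℝ) • y = 0 := by
    rintro _ ⟨_, ⟨x, hx, rfl⟩, rfl⟩
    obtain ⟨y, hy, e⟩ := hp x hx
    refine ⟨_, ⟨_, ⟨y, hy, rfl⟩, rfl⟩, ?_⟩
    simp only
    rw [smul_comm (n : ℝ), ← smul_add]
    have : -p + x + (n : ℝ) • (-p + y) = (x + (n : ℝ) • y) - ((n : ℝ) + 1) • p := by
      module
    rw [this, e, sub_self, smul_zero]
  obtain ⟨c, hc0, hLcube⟩ := exists_subset_cube hLc.isBounded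
  -- The additive constant pays for rounding the number of greedy copies up to an integer.
  refine ⟨2 * c, volume.real K, fun R hR => ?_⟩
  set V := (2 * (R + 2 * c)) ^ n with hV
  have hVpos : 0 < V := by positivity
  -- This threshold makes the uncovered fraction at most `exp (-l) = η ^ n`, so the packed copies
  -- have total volume at most `V`.
  set l := -((n : ℝ) * Real.log η) with hl
  have hl0 : 0 ≤ l := by
    have := Real.log_nonpos h0.le hη1
    rw [hl]; nlinarith
  obtain ⟨M, hM, hM'⟩ := exists_covering_enlarged hn hLconv hLc hLpos hLr h0 h1 hc0 hLcube hR
    ⌈l / (volume.real L / V)⌉₊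
  set N := ⌈l / (volume.real L / V)⌉₊ with hN
  refine ⟨N + M, hM.of_translate p ?_, ?_⟩
  · intro b hb
    rw [hL, smul_inv_smul₀ h1η.ne'] at hb
    obtain ⟨k, hk, rfl⟩ := hb
    simpa using hk
  · have hN1 : l ≤ N * (volume.real L / V) := by
      rw [← div_le_iff₀ (by positivity)]; exact Nat.le_ceil _
    have hN2 : N * volume.real L ≤ l * V + volume.real L := by
      have := (Nat.ceil_lt_add_one (div_nonneg hl0 (by positivity : 0 ≤ volume.real L / V))).le
      rw [← hN] at this
      calc N * volume.real L ≤ (l / (volume.real L / V) + 1) * volume.real L := by gcongr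
        _ = _ := by field_simp
    have hexp : Real.exp (-(N * (volume.real L / V))) ≤ η ^ n := by
      calc _ ≤ Real.exp (-l) := Real.exp_le_exp.2 (by linarith)
        _ = η ^ n := by rw [hl, neg_neg, Real.exp_nat_mul, Real.exp_log h0]
    have hM2 : M * volume.real L ≤ V := by
      have h2 : (M * volume.real L) * η ^ n ≤ V * η ^ n := by
        calc _ = M * (η ^ n * volume.real L) := by ring
          _ ≤ _ := hM'
          _ ≤ η ^ n * V := by
            rw [hV]; gcongr; linarith
          _ = _ := by ring
      exact le_of_mul_le_mul_right h2 (by positivity)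
    have hfin : (N + M : ℝ) * volume.real L ≤ (1 + l) * V + volume.real L := by linarith
    have hKL : volume.real K = (1 + η) ^ n * volume.real L := by rw [hLv]; field_simp
    have hpow : 0 < (1 + η) ^ n := by positivity
    calc ((N + M : ℕ) : ℝ) * volume.real K = (1 + η) ^ n * ((N + M : ℝ) * volume.real L) := by
          rw [hKL]; push_cast; ring
      _ ≤ (1 + η) ^ n * ((1 + l) * V + volume.real L) := by gcongr
      _ = _ := by rw [hKL, rogersFun, hl]; ring

end Covering

/-! ### Existence of the covering density and Rogers' bound -/

section Density
variable {n : ℕ}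

/-- A Fekete-type argument: for fixed `R` the factor tends to `1` as `S → ∞`, so `d` is eventually
below anything larger than its infimum. -/
theorem tendsto_of_le_one_add_div_pow_mul {d : ℝ → ℝ} (h0 : ∀ R, 0 < R → 0 ≤ d R)
    (h : ∀ R S, 0 < R → 0 < S → d S ≤ (1 + R / S) ^ n * d R) :
    Tendsto d atTop (𝓝 (sInf (d '' Ioi 0))) := by
  have hbdd : BddBelow (d '' Ioi 0) := ⟨0, by rintro _ ⟨R, hR, rfl⟩; exact h0 R hR⟩
  refine tendsto_order.2 ⟨fun a ha => ?_, fun a ha => ?_⟩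
  · filter_upwards [eventually_gt_atTop 0] with S hS
    exact ha.trans_le (csInf_le hbdd ⟨S, hS, rfl⟩)
  · obtain ⟨_, ⟨R, hR, rfl⟩, hRa⟩ := exists_lt_of_csInf_lt (nonempty_Ioi.image d) ha
    have hlim : Tendsto (fun S : ℝ => (1 + R / S) ^ n * d R) atTop (𝓝 ((1 + 0) ^ n * d R)) :=
      ((tendsto_const_nhds.add (tendsto_const_nhds.div_atTop tendsto_id)).pow n).mul_const _
    rw [add_zero, one_pow, one_mul] at hlim
    filter_upwards [hlim.eventually (gt_mem_nhds hRa), eventually_gt_atTop 0] with S hS hS0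
    exact (h R S hR hS0).trans_lt hS

theorem tendsto_mul_add_pow_add_div (hn : 1 ≤ n) (F c C : ℝ) :
    Tendsto (fun R : ℝ => (F * (2 * (R + c)) ^ n + C) / (2 * R) ^ n) atTop (𝓝 F) := by
  have h1 : Tendsto (fun R : ℝ => F * (1 + c / R) ^ n + C / (2 * R) ^ n) atTop
      (𝓝 (F * (1 + 0) ^ n + 0)) := by
    refine Tendsto.add (Tendsto.const_mul _ ((tendsto_const_nhds.add
      (tendsto_const_nhds.div_atTop tendsto_id)).pow n)) (tendsto_const_nhds.div_atTop ?_)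
    exact (tendsto_pow_atTop (by omega)).comp (tendsto_id.const_mul_atTop two_pos)
  simp only [add_zero, one_pow, mul_one] at h1
  refine h1.congr' ?_
  filter_upwards [eventually_gt_atTop 0] with R hR
  rw [add_div, mul_div_assoc, ← div_pow]
  congr 3
  field_simp

theorem cubeDensity_le {L : Set (E n)} {R : ℝ} (hR : 0 < R) {N : ℕ}
    (h : CoveredByTranslates (cube n R) L N) :
    cubeDensity L R ≤ volume.real L * (N : ℝ) / (2 * R) ^ n := by
  refine csInf_le ⟨0, ?_⟩ ⟨N, h, rfl⟩
  rintro _ ⟨N, -, rfl⟩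
  positivity

theorem cubeDensity_nonneg {L : Set (E n)} {R : ℝ} (hR : 0 < R) : 0 ≤ cubeDensity L R := by
  refine Real.sInf_nonneg ?_
  rintro _ ⟨N, -, rfl⟩
  positivity

/-- The cube of radius `S` fits in a block of `⌈S / R⌉₊ ^ n` cubes of radius `R`, each covered in
the same way. -/
theorem cubeDensity_le_one_add_div_pow_mul {L : Set (E n)}
    (hL : ∀ R : ℝ, 0 < R → ∃ N : ℕ, CoveredByTranslates (cube n R) L N) {R S : ℝ} (hR : 0 < R)
    (hS : 0 < S) : cubeDensity L S ≤ (1 + R / S) ^ n * cubeDensity L R := by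
  rw [← div_le_iff₀' (by positivity)]
  obtain ⟨N₀, hN₀⟩ := hL R hR
  refine le_csInf ⟨_, N₀, hN₀, rfl⟩ ?_
  rintro _ ⟨N, hN, rfl⟩
  rw [div_le_iff₀' (by positivity)]
  set m := ⌈S / R⌉₊ with hm
  have hm1 : 1 ≤ m := Nat.ceil_pos.2 (by positivity)
  have hm2 : S ≤ m * R := by rw [← div_le_iff₀ hR]; exact Nat.le_ceil _
  have hm3 : (m : ℝ) ≤ S / R + 1 := (Nat.ceil_lt_add_one (by positivity)).le
  have hcov := ((coveredByTranslates_cube_cube (n := n) hR hm1).trans hN).mono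
    (cube_mono hm2) Subset.rfl
  refine (cubeDensity_le hS hcov).trans ?_
  calc volume.real L * ((m ^ n * N : ℕ) : ℝ) / (2 * S) ^ n
      = volume.real L * N * (m / (2 * S)) ^ n := by push_cast; rw [div_pow]; ring
    _ ≤ volume.real L * N * ((S / R + 1) / (2 * S)) ^ n := by gcongr
    _ = volume.real L * N * ((1 + R / S) / (2 * R)) ^ n := by congr 2; field_simp
    _ = _ := by rw [div_pow]; ring

theorem tendsto_cubeDensity {L : Set (E n)}
    (hL : ∀ R : ℝ, 0 < R → ∃ N : ℕ, CoveredByTranslates (cube n R) L N) :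
    Tendsto (fun R : ℝ => cubeDensity L R) atTop (𝓝 (coveringDensity L)) := by
  have := tendsto_of_le_one_add_div_pow_mul (fun R hR => cubeDensity_nonneg (L := L) hR)
    fun R S hR hS => cubeDensity_le_one_add_div_pow_mul hL hR hS
  rwa [coveringDensity, this.limUnder_eq]

theorem tendsto_cubeDensity_of_convex (hn : 1 ≤ n) {K : Set (E n)} (hc : Convex ℝ K)
    (hK : IsCompact K) (hi : (interior K).Nonempty) :
    Tendsto (fun R : ℝ => cubeDensity K R) atTop (𝓝 (coveringDensity K)) := by
  have hn' : (1 : ℝ) ≤ n := by exact_mod_cast hn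
  obtain ⟨c, C, h⟩ := exists_covering_cube hn hc hK hi (η := 1 / n) (by positivity) le_rfl
  exact tendsto_cubeDensity fun R hR => (h R hR).imp fun N hN => hN.1

theorem coveringDensity_le_rogersFun (hn : 1 ≤ n) {K : Set (E n)} (hc : Convex ℝ K)
    (hK : IsCompact K) (hi : (interior K).Nonempty) {η : ℝ} (h0 : 0 < η) (h1 : η ≤ 1 / n) :
    coveringDensity K ≤ rogersFun n η := by
  obtain ⟨c, C, h⟩ := exists_covering_cube hn hc hK hi h0 h1
  refine le_of_tendsto_of_tendsto (tendsto_cubeDensity_of_convex hn hc hK hi)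
    (tendsto_mul_add_pow_add_div hn (rogersFun n η) c C) ?_
  filter_upwards [eventually_gt_atTop 0] with R hR
  obtain ⟨N, hN, hN'⟩ := h R hR
  refine (cubeDensity_le hR hN).trans ?_
  rw [mul_comm]
  gcongr

end Density

/-! ### From covering cubes to covering a body by its interior -/

section Average
open scoped Pointwise
variable {n : ℕ}

theorem _root_.IsCompact.sub_set {A B : Set (E n)} (hA : IsCompact A) (hB : IsCompact B) :
    IsCompact (A - B) := by
  rw [sub_eq_add_neg]; exact hA.add hB.neg

/-- Integrality turns bounds that hold only in a limit into exact ones: some `y > x` lies below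
`⌊x⌋₊ + 1`. -/
theorem exists_nat_le_of_forall_lt {P : ℕ → Prop} {x : ℝ} (hx : 0 ≤ x)
    (h : ∀ y, x < y → ∃ N : ℕ, P N ∧ (N : ℝ) ≤ y) : ∃ N : ℕ, P N ∧ (N : ℝ) ≤ x := by
  have h1 := Nat.lt_floor_add_one x
  obtain ⟨N, hN, hN'⟩ := h ((x + (⌊x⌋₊ + 1)) / 2) (by linarith)
  refine ⟨N, hN, ?_⟩
  have : (N : ℝ) < (⌊x⌋₊ + 1 : ℕ) := by push_cast; linarith
  have : N ≤ ⌊x⌋₊ := Nat.lt_succ_iff.1 (by exact_mod_cast this)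
  exact (Nat.cast_le.2 this).trans (Nat.floor_le hx)

/-- Averaging over the translates of `A` that lie in a cube. -/
theorem CoveredByTranslates.exists_shift {A L : Set (E n)} (hA : IsCompact A) (hL : IsCompact L)
    {a R : ℝ} (hAa : A ⊆ cube n a) (hR : 0 < R) {N : ℕ}
    (h : CoveredByTranslates (cube n (R + a)) L N) :
    ∃ M : ℕ, CoveredByTranslates A L M ∧ M * (2 * R) ^ n ≤ N * volume.real (L - A) := by
  classical
  obtain ⟨t, ht⟩ := h.exists_mem
  have hD : MeasurableSet (L - A) := (hL.sub_set hA).measurableSet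
  have hDt : volume (L - A) ≠ ⊤ := (hL.sub_set hA).measure_lt_top.ne
  -- Counts the copies `t j + L` that meet `s + A`, since this happens exactly when `s - t j ∈ L -
  -- A`.
  let f : E n → ℝ≥0∞ := fun s => ∑ j, ((fun s => s - t j) ⁻¹' (L - A)).indicator 1 s
  have hpre : ∀ j, MeasurableSet ((fun s => s - t j) ⁻¹' (L - A)) := fun j =>
    (measurable_id.sub_const (t j)) hD
  have hf : Measurable f := Finset.measurable_fun_sum _ fun j _ => measurable_one.indicator (hpre j)
  have hQ0 : volume (cube n R) ≠ 0 := by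
    rw [volume_cube hR.le]
    simp only [ne_eq, ENNReal.ofReal_eq_zero, not_le]
    positivity
  obtain ⟨s, hs, hsf⟩ := exists_le_setLAverage hQ0 (volume_cube_ne_top hR.le) hf.aemeasurable.restrict
  have hint : ∫⁻ s in cube n R, f s ≤ N * volume (L - A) := by
    calc ∫⁻ s in cube n R, f s ≤ ∫⁻ s, f s := setLIntegral_le_lintegral _ _
      _ = ∑ j : Fin N, volume ((fun s => s - t j) ⁻¹' (L - A)) := by
        simp only [f]
        rw [lintegral_finsetSum _ fun j _ => measurable_one.indicator (hpre j)]
        exact Finset.sum_congr rfl fun j _ => lintegral_indicator_one (hpre j)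
      _ = N * volume (L - A) := by
        simp [sub_eq_add_neg, measure_preimage_add_right]
  have hfs : f s = (Nat.card {j // s - t j ∈ L - A} : ℝ≥0∞) := by
    simp only [f, indicator_apply, mem_preimage, Pi.one_apply, Finset.sum_boole]
    rw [Nat.card_eq_fintype_card, Fintype.card_subtype]
  refine ⟨Nat.card {j // s - t j ∈ L - A},
    coveredByTranslates_of_finite (fun j => t j.1 - s) fun x hx => ?_, ?_⟩
  · obtain ⟨i, b, hb, e⟩ := ht (s + x) (add_mem_cube hs (hAa hx))
    refine ⟨⟨i, b, hb, x, hx, ?_⟩, b, hb, ?_⟩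
    · rw [eq_sub_iff_add_eq.2 ((add_comm b (t i)).trans e)]
      simp only; abel
    · simp only
      rw [sub_add_eq_add_sub, e]; abel
  · rw [setLAverage_eq, ENNReal.le_div_iff_mul_le (Or.inl hQ0) (Or.inl (volume_cube_ne_top hR.le)),
      hfs, volume_cube hR.le] at hsf
    have := ENNReal.toReal_mono (ENNReal.mul_ne_top (by simp) hDt) (hsf.trans hint)
    rwa [ENNReal.toReal_mul, ENNReal.toReal_mul, ENNReal.toReal_ofReal (by positivity),
      ENNReal.toReal_natCast, ENNReal.toReal_natCast, ← measureReal_def] at this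

theorem exists_covering_of_covering_cubes (hn : 1 ≤ n) {A L : Set (E n)} (hA : IsCompact A)
    (hL : IsCompact L) (hv : 0 < volume.real L) {F c C : ℝ} (hF : 0 ≤ F)
    (h : ∀ R : ℝ, 0 < R → ∃ N : ℕ, CoveredByTranslates (cube n R) L N ∧
      N * volume.real L ≤ F * (2 * (R + c)) ^ n + C) :
    ∃ N : ℕ, CoveredByTranslates A L N ∧
      (N : ℝ) ≤ F * (volume.real (L - A) / volume.real L) := by
  refine exists_nat_le_of_forall_lt (by positivity) fun y hy => ?_
  obtain ⟨a, ha, hAa⟩ := exists_subset_cube hA.isBounded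
  have hlim := (tendsto_mul_add_pow_add_div hn F (a + c) C).mul_const
    (volume.real (L - A) / volume.real L)
  obtain ⟨R, hRy, hR⟩ := ((hlim.eventually (gt_mem_nhds hy)).and (eventually_gt_atTop 0)).exists
  obtain ⟨N, hN, hN'⟩ := h (R + a) (by linarith)
  obtain ⟨M, hM, hM'⟩ := hN.exists_shift hA hL hAa hR
  refine ⟨M, hM, le_trans ?_ hRy.le⟩
  rw [div_mul_div_comm, le_div_iff₀ (by positivity)]
  calc M * ((2 * R) ^ n * volume.real L) = M * (2 * R) ^ n * volume.real L := by ring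
    _ ≤ N * volume.real (L - A) * volume.real L := by gcongr
    _ = N * volume.real L * volume.real (L - A) := by ring
    _ ≤ _ := by rw [← add_assoc]; gcongr

theorem smul_subset_interior {K : Set (E n)} (hc : Convex ℝ K) (h0 : 0 ∈ interior K) {l : ℝ}
    (hl0 : 0 ≤ l) (hl1 : l < 1) : l • K ⊆ interior K := by
  rintro _ ⟨x, hx, rfl⟩
  have := hc.combo_interior_self_mem_interior h0 hx (a := 1 - l) (b := l) (by linarith) hl0 (by ring)
  simpa using this

/-- Translates of `l • K` with `l < 1` lie in translates of the interior. They cost a factor `(l ^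
n)⁻¹`, which disappears as `l → 1`. -/
theorem exists_covering_interior_of_zero_mem (hn : 1 ≤ n) {K : Set (E n)} (hc : Convex ℝ K)
    (hK : IsCompact K) (h0 : 0 ∈ interior K) {η : ℝ} (hη0 : 0 < η) (hη1 : η ≤ 1 / n) :
    ∃ N : ℕ, CoveredByTranslates K (interior K) N ∧
      (N : ℝ) ≤ rogersFun n η * (volume.real (K - K) / volume.real K) := by
  have hn' : (1 : ℝ) ≤ n := by exact_mod_cast hn
  have hF : 0 ≤ rogersFun n η := by
    have h1 : Real.log η ≤ 0 := Real.log_nonpos hη0.le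
      (hη1.trans (by rw [div_le_one (by linarith)]; exact hn'))
    have : 0 ≤ 1 - n * Real.log η := by nlinarith
    rw [rogersFun]; positivity
  have hKv : 0 < volume.real K :=
    ENNReal.toReal_pos (Measure.measure_pos_of_nonempty_interior _ ⟨0, h0⟩).ne'
      hK.measure_lt_top.ne
  set X := rogersFun n η * (volume.real (K - K) / volume.real K) with hX
  refine exists_nat_le_of_forall_lt (by positivity) fun y hy => ?_
  have hlim : Tendsto (fun l : ℝ => (l ^ n)⁻¹ * X) (𝓝[<] 1) (𝓝 ((1 ^ n)⁻¹ * X)) :=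
    ((((continuous_pow n).tendsto 1).inv₀ (by simp)).mul_const X).mono_left nhdsWithin_le_nhds
  rw [one_pow, inv_one, one_mul] at hlim
  obtain ⟨l, hly, hl0, hl1⟩ := ((hlim.eventually (gt_mem_nhds hy)).and
    (Ioo_mem_nhdsLT (zero_lt_one' ℝ))).exists
  have hLK := smul_subset_interior hc h0 hl0.le hl1
  have hLv : volume.real (l • K) = l ^ n * volume.real K := by
    rw [measureReal_def, Measure.addHaar_smul, ENNReal.toReal_mul,
      ENNReal.toReal_ofReal (abs_nonneg _), finrank_euclideanSpace, Fintype.card_fin,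
      abs_of_pos (by positivity), measureReal_def]
  have hLi : (interior (l • K)).Nonempty := by
    rw [interior_smul₀ hl0.ne']
    exact ⟨_, 0, h0, rfl⟩
  obtain ⟨c, C, h⟩ := exists_covering_cube hn (hc.smul l) (hK.smul l) hLi hη0 hη1
  obtain ⟨N, hN, hN'⟩ := exists_covering_of_covering_cubes hn hK (hK.smul l)
    (by rw [hLv]; positivity) hF h
  refine ⟨N, hN.mono Subset.rfl hLK, hN'.trans (le_trans ?_ hly.le)⟩
  have hsub : volume.real (l • K - K) ≤ volume.real (K - K) :=
    measureReal_mono (Set.sub_subset_sub_right (hLK.trans interior_subset))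
      (hK.sub_set hK).measure_lt_top.ne
  rw [hLv, hX]
  calc _ ≤ rogersFun n η * (volume.real (K - K) / (l ^ n * volume.real K)) := by gcongr
    _ = _ := by field_simp

theorem exists_covering_interior (hn : 1 ≤ n) {K : Set (E n)} (hc : Convex ℝ K)
    (hK : IsCompact K) (hi : (interior K).Nonempty) {η : ℝ} (hη0 : 0 < η) (hη1 : η ≤ 1 / n) :
    ∃ N : ℕ, CoveredByTranslates K (interior K) N ∧
      (N : ℝ) ≤ rogersFun n η * (volume.real (K - K) / volume.real K) := by
  obtain ⟨p, hp⟩ := hi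
  have himg : (fun x => -p + x) '' K = -p +ᵥ K := rfl
  have hint : interior (-p +ᵥ K) = -p +ᵥ interior K := interior_vadd _ _
  have hsub : (-p +ᵥ K) - (-p +ᵥ K) = K - K := by
    ext z
    simp only [Set.mem_sub, mem_vadd_set, vadd_eq_add]
    constructor
    · rintro ⟨_, ⟨x, hx, rfl⟩, _, ⟨y, hy, rfl⟩, rfl⟩
      exact ⟨x, hx, y, hy, by abel⟩
    · rintro ⟨x, hx, y, hy, rfl⟩
      exact ⟨_, ⟨x, hx, rfl⟩, _, ⟨y, hy, rfl⟩, by abel⟩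
  obtain ⟨N, hN, hN'⟩ := exists_covering_interior_of_zero_mem hn (K := -p +ᵥ K)
    (hc.vadd _) (hK.vadd _) (by rw [hint]; exact ⟨p, hp, by simp⟩) hη0 hη1
  have hv : volume.real (-p +ᵥ K) = volume.real K := by
    simp [measureReal_def, measure_vadd]
  rw [hsub, hv] at hN'
  refine ⟨N, ?_, hN'⟩
  obtain ⟨t, ht⟩ := hN.exists_mem
  have := coveredByTranslates_of_finite (A := K) (B := interior K) t fun x hx => by
    obtain ⟨i, b, hb, e⟩ := ht _ ⟨x, hx, rfl⟩
    rw [hint] at hb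
    obtain ⟨k, hk, rfl⟩ := hb
    refine ⟨i, k, hk, ?_⟩
    simp only [vadd_eq_add] at e
    have : t i + k = p + (t i + (-p + k)) := by abel
    rw [this, e]; abel
  simpa using this

end Average

/-! ### The Beta integral behind the binomial coefficient -/

section BetaIntegral
open scoped Nat

theorem integral_pow_mul_one_sub_pow (a b : ℕ) :
    ∫ t in (0 : ℝ)..1, t ^ a * (1 - t) ^ b = (a ! * b ! : ℝ) / (a + b + 1)! := by
  induction b generalizing a with
  | zero =>
    simp only [pow_zero, mul_one, integral_pow, Nat.factorial_succ, Nat.factorial_zero, add_zero]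
    have : (a ! : ℝ) ≠ 0 := by positivity
    push_cast
    field_simp
    simp
  | succ b ih =>
    have hd : ∀ t ∈ uIcc (0 : ℝ) 1, HasDerivAt (fun t : ℝ => t ^ (a + 1) * (1 - t) ^ (b + 1))
        ((a + 1) * (t ^ a * (1 - t) ^ (b + 1)) - (b + 1) * (t ^ (a + 1) * (1 - t) ^ b)) t := by
      intro t _
      have h1 := (hasDerivAt_pow (a + 1) t).mul
        ((((hasDerivAt_id t).const_sub 1)).pow (b + 1))
      refine h1.congr_deriv ?_
      simp
      ring
    have hi := intervalIntegral.integral_eq_sub_of_hasDerivAt hd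
      (Continuous.intervalIntegrable (by fun_prop) _ _)
    rw [intervalIntegral.integral_sub (Continuous.intervalIntegrable (by fun_prop) _ _)
      (Continuous.intervalIntegrable (by fun_prop) _ _), intervalIntegral.integral_const_mul,
      intervalIntegral.integral_const_mul, ih (a + 1)] at hi
    have e : a + 1 + b + 1 = a + (b + 1) + 1 := by ring
    rw [e] at hi
    have ha : ((a : ℝ) + 1) ≠ 0 := by positivity
    simp only [sub_self, one_pow, ne_eq, Nat.add_eq_zero_iff, one_ne_zero, and_false, not_false_eq_true, zero_pow, mul_zero, sub_zero, zero_mul] at hi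
    have h2 : ((a : ℝ) + 1) * (∫ t in (0 : ℝ)..1, t ^ a * (1 - t) ^ (b + 1))
        = (b + 1) * (((a + 1)! * b ! : ℝ) / (a + (b + 1) + 1)!) := by linarith
    apply mul_left_cancel₀ ha
    rw [h2, Nat.factorial_succ a, Nat.factorial_succ b]
    push_cast
    ring

theorem integral_one_sub_pow_mul_deriv_pow {n : ℕ} (hn : 1 ≤ n) :
    ∫ t in (0 : ℝ)..1, (1 - t) ^ n * (n * t ^ (n - 1)) = ((2 * n).choose n : ℝ)⁻¹ := by
  obtain ⟨k, rfl⟩ : ∃ k, n = k + 1 := ⟨n - 1, by omega⟩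
  have h : ∀ t : ℝ, (1 - t) ^ (k + 1) * (((k + 1 : ℕ) : ℝ) * t ^ (k + 1 - 1))
      = ((k + 1 : ℕ) : ℝ) * (t ^ k * (1 - t) ^ (k + 1)) := fun t => by
    simp only [Nat.add_sub_cancel]; ring
  simp_rw [h]
  rw [intervalIntegral.integral_const_mul, integral_pow_mul_one_sub_pow,
    Nat.cast_choose ℝ (by omega : k + 1 ≤ 2 * (k + 1)),
    show 2 * (k + 1) - (k + 1) = k + 1 by omega, show k + (k + 1) + 1 = 2 * (k + 1) by ring,
    Nat.factorial_succ k]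
  push_cast
  field_simp

end BetaIntegral

/-! ### Volume of the difference body -/

section RogersShephard
open scoped Pointwise
variable {n : ℕ}

/-- The common part of `K` and a translate contains a homothetic copy of `K`. -/
theorem pow_mul_volume_le_volume_inter_translate {K : Set (E n)} (hc : Convex ℝ K)
    (hK : IsCompact K) {t : ℝ} (h0 : 0 < t) (h1 : t ≤ 1) {x : E n} (hx : x ∈ (1 - t) • (K - K)) :
    t ^ n * volume.real K ≤ volume.real {z | z ∈ K ∧ z - x ∈ K} := by
  obtain ⟨_, ⟨a, ha, b, hb, rfl⟩, rfl⟩ := hx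
  have hv : volume.real ((1 - t) • a +ᵥ t • K) = t ^ n * volume.real K := by
    rw [measureReal_def, measure_vadd, Measure.addHaar_smul, ENNReal.toReal_mul,
      ENNReal.toReal_ofReal (abs_nonneg _), finrank_euclideanSpace, Fintype.card_fin,
      abs_of_pos (by positivity), measureReal_def]
  rw [← hv]
  refine measureReal_mono ?_ (measure_ne_top_of_subset (fun z hz => hz.1) hK.measure_lt_top.ne)
  rintro _ ⟨_, ⟨k, hk, rfl⟩, rfl⟩
  refine ⟨hc ha hk (by linarith) h0.le (by ring), ?_⟩
  have e : ((1 - t) • a +ᵥ (fun x => t • x) k) - (fun x => (1 - t) • x) ((fun x1 x2 => x1 - x2) a b)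
      = (1 - t) • b + t • k := by
    simp only [vadd_eq_add, smul_sub]; abel
  rw [e]
  exact hc hb hk (by linarith) h0.le (by ring)

/-- The **Rogers-Shephard inequality** for the difference body. -/
theorem volume_sub_self_le (hn : 1 ≤ n) {K : Set (E n)} (hc : Convex ℝ K) (hK : IsCompact K)
    (hv : 0 < volume.real K) :
    volume.real (K - K) ≤ (2 * n).choose n * volume.real K := by
  have hn0 : n ≠ 0 := by omega
  have hKt : volume K ≠ ⊤ := hK.measure_lt_top.ne
  have hDt : volume (K - K) ≠ ⊤ := (hK.sub_set hK).measure_lt_top.ne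
  let φ : E n → ℝ := fun x => volume.real {z | z ∈ K ∧ z - x ∈ K} / volume.real K
  have hφ0 : ∀ x, 0 ≤ φ x := fun x => by positivity
  have hφm : Measurable φ :=
    ((measurable_measure_prodMk_left
      (measurableSet_prod_sub hK.measurableSet hK.measurableSet)).ennreal_toReal).div_const _
  -- With this root, `{x | t ≤ f x}` contains `(1 - t) • (K - K)` for `0 < t ≤ 1`. The layer-cake
  -- formula with weight `n t ^ (n - 1)` recovers `∫ φ`, which equals `|K|` by Fubini.
  let f : E n → ℝ := fun x => φ x ^ ((n : ℝ)⁻¹)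
  have hf0 : ∀ x, 0 ≤ f x := fun x => Real.rpow_nonneg (hφ0 x) _
  have hfm : Measurable f := hφm.pow_const _
  have hfn : ∀ x, f x ^ n = φ x := fun x => Real.rpow_inv_natCast_pow (hφ0 x) hn0
  have hint : ∀ x, ∫ t in (0 : ℝ)..f x, (n : ℝ) * t ^ (n - 1) = φ x := fun x => by
    rw [intervalIntegral.integral_const_mul, integral_pow, ← hfn x, Nat.sub_add_cancel hn,
      zero_pow hn0, Nat.cast_sub hn]
    simp only [Nat.cast_one, sub_add_cancel, sub_zero]
    field_simp
  have hcake := lintegral_comp_eq_lintegral_meas_le_mul (volume : Measure (E n))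
    (f := f) (g := fun t => (n : ℝ) * t ^ (n - 1)) (Eventually.of_forall hf0) hfm.aemeasurable
    (fun t _ => Continuous.intervalIntegrable (by fun_prop) _ _)
    ((ae_restrict_iff' measurableSet_Ioi).2 (Eventually.of_forall fun t (ht : 0 < t) => by positivity))
  simp only [hint] at hcake
  have hleft : ∫⁻ x, ENNReal.ofReal (φ x) = volume K := by
    have h1 : ∀ x, ENNReal.ofReal (φ x) = volume {z | z ∈ K ∧ z - x ∈ K} * (volume K)⁻¹ := fun x => by
      have hxt : volume {z | z ∈ K ∧ z - x ∈ K} ≠ ⊤ :=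
        measure_ne_top_of_subset (fun z hz => hz.1) hKt
      simp only [φ]
      rw [ENNReal.ofReal_div_of_pos hv, ofReal_measureReal hxt, ofReal_measureReal hKt,
        ENNReal.div_eq_inv_mul, mul_comm]
    have hK0 : volume K ≠ 0 := fun h => by simp [measureReal_def, h] at hv
    simp_rw [h1]
    have hm : Measurable fun x : E n => volume {z | z ∈ K ∧ z - x ∈ K} :=
      measurable_measure_prodMk_left (measurableSet_prod_sub hK.measurableSet hK.measurableSet)
    rw [lintegral_mul_const _ hm, lintegral_volume_inter_translate hK.measurableSet hK.measurableSet, mul_assoc,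
      ENNReal.mul_inv_cancel hK0 hKt, mul_one]
  have hright : volume (K - K) * ENNReal.ofReal ((2 * n).choose n : ℝ)⁻¹ ≤
      ∫⁻ t in Ioi 0, volume {x | t ≤ f x} * ENNReal.ofReal ((n : ℝ) * t ^ (n - 1)) := by
    have hnn : ∀ t ∈ Ioc (0 : ℝ) 1, 0 ≤ (1 - t) ^ n * ((n : ℝ) * t ^ (n - 1)) := fun t ht => by
      have := ht.1; have : 0 ≤ 1 - t := by linarith [ht.2]
      positivity
    calc volume (K - K) * ENNReal.ofReal ((2 * n).choose n : ℝ)⁻¹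
        = volume (K - K) * ∫⁻ t in Ioc (0 : ℝ) 1, ENNReal.ofReal ((1 - t) ^ n * ((n : ℝ) * t ^ (n - 1))) := by
          rw [← integral_one_sub_pow_mul_deriv_pow hn,
            intervalIntegral.integral_of_le zero_le_one, ofReal_integral_eq_lintegral_ofReal]
          · exact (Continuous.integrableOn_Icc (by fun_prop)).mono_set Ioc_subset_Icc_self
          · exact (ae_restrict_iff' measurableSet_Ioc).2 (Eventually.of_forall hnn)
      _ = ∫⁻ t in Ioc (0 : ℝ) 1, volume (K - K) * ENNReal.ofReal ((1 - t) ^ n * ((n : ℝ) * t ^ (n - 1))) := by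
          rw [lintegral_const_mul _ (by fun_prop)]
      _ ≤ ∫⁻ t in Ioc (0 : ℝ) 1, volume {x | t ≤ f x} * ENNReal.ofReal ((n : ℝ) * t ^ (n - 1)) := by
          refine setLIntegral_mono' measurableSet_Ioc fun t ht => ?_
          have h1t : 0 ≤ 1 - t := by linarith [ht.2]
          rw [ENNReal.ofReal_mul (by positivity), ← mul_assoc]
          gcongr
          have : volume ((1 - t) • (K - K)) = volume (K - K) * ENNReal.ofReal ((1 - t) ^ n) := by
            rw [Measure.addHaar_smul, finrank_euclideanSpace, Fintype.card_fin,
              abs_of_nonneg (by positivity), mul_comm]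
          rw [← this]
          refine measure_mono fun x hx => ?_
          have := pow_mul_volume_le_volume_inter_translate hc hK ht.1 ht.2 hx
          have h2 : t ^ n ≤ φ x := by rwa [le_div_iff₀ hv]
          calc t = (t ^ n) ^ ((n : ℝ)⁻¹) := (Real.pow_rpow_inv_natCast ht.1.le hn0).symm
            _ ≤ f x := Real.rpow_le_rpow (pow_nonneg ht.1.le _) h2 (by positivity)
      _ ≤ _ := lintegral_mono_set Ioc_subset_Ioi_self
  rw [← hcake, hleft] at hright
  have hch : (0 : ℝ) < (2 * n).choose n := by
    exact_mod_cast Nat.choose_pos (by omega)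
  have := ENNReal.toReal_mono hKt hright
  rw [ENNReal.toReal_mul, ENNReal.toReal_ofReal (by positivity), ← measureReal_def,
    ← measureReal_def, ← div_eq_mul_inv, div_le_iff₀ hch] at this
  linarith

/-- Symmetry turns `-K` into `K - 2c`, and convexity gives `K + K = 2 K`. -/
theorem volume_sub_self_of_symm {K : Set (E n)} (hc : Convex ℝ K) {c : E n}
    (hs : ∀ x ∈ K, (2 : ℝ) • c - x ∈ K) : volume.real (K - K) = 2 ^ n * volume.real K := by
  have h : K - K = -((2 : ℝ) • c) +ᵥ (2 : ℝ) • K := by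
    have h2 : (2 : ℝ) • K = K + K := by
      have := hc.add_smul (zero_le_one (α := ℝ)) zero_le_one
      rwa [one_add_one_eq_two, one_smul] at this
    rw [h2]
    ext z
    simp only [Set.mem_sub, mem_vadd_set, Set.mem_add, vadd_eq_add]
    constructor
    · rintro ⟨x, hx, y, hy, rfl⟩
      exact ⟨_, ⟨x, hx, _, hs y hy, rfl⟩, by abel⟩
    · rintro ⟨_, ⟨x, hx, y, hy, rfl⟩, rfl⟩
      exact ⟨x, hx, _, hs y hy, by abel⟩
  rw [h, measureReal_def, measure_vadd, Measure.addHaar_smul, ENNReal.toReal_mul,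
    ENNReal.toReal_ofReal (abs_nonneg _), finrank_euclideanSpace, Fintype.card_fin,
    abs_of_pos (by positivity), measureReal_def]

end RogersShephard

/-! ### Attainment and upper estimates of the minimum -/

section RogersConst

theorem hasDerivAt_rogersFun (n : ℕ) {x : ℝ} (hx : x ≠ 0) :
    HasDerivAt (rogersFun n)
      (n * (1 + x) ^ (n - 1) * (1 - n * Real.log x) - (1 + x) ^ n * (n * x⁻¹)) x := by
  have h1 : HasDerivAt (fun x : ℝ => (1 + x) ^ n) (n * (1 + x) ^ (n - 1)) x := by
    simpa using ((hasDerivAt_id x).const_add 1).fun_pow n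
  have h2 : HasDerivAt (fun x : ℝ => 1 - n * Real.log x) (-(n * x⁻¹)) x :=
    ((Real.hasDerivAt_log hx).const_mul (n : ℝ)).const_sub 1
  refine (h1.mul h2).congr_deriv ?_
  ring

theorem one_lt_log_of_three_le {n : ℕ} (hn : 3 ≤ n) : 1 < Real.log n := by
  have h3 : (3 : ℝ) ≤ n := by exact_mod_cast hn
  have := Real.log_le_log (by norm_num) h3
  linarith [Real.log_three_gt_d9]

/-- The derivative at `1 / n` is `n ^ 2 * (1 + 1 / n) ^ (n - 1) * (log n - 1)`, which is positive
because `n ≥ 3 > e`. Hence the minimum is not at the right end. -/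
theorem exists_rogersFun_lt {n : ℕ} (hn : 3 ≤ n) :
    ∃ x ∈ Ioo (0 : ℝ) (1 / n), rogersFun n x < rogersFun n (1 / n) := by
  have h3 : (3 : ℝ) ≤ n := by exact_mod_cast hn
  have hn0 : (0 : ℝ) < n := by linarith
  have hpos : (0 : ℝ) < 1 / n := by positivity
  have hd := hasDerivAt_rogersFun n hpos.ne'
  have hd0 : 0 < (n * (1 + 1 / (n : ℝ)) ^ (n - 1) * (1 - n * Real.log (1 / n)) -
      (1 + 1 / (n : ℝ)) ^ n * (n * (1 / (n : ℝ))⁻¹)) := by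
    obtain ⟨k, rfl⟩ : ∃ k, n = k + 1 := ⟨n - 1, by omega⟩
    have hl := one_lt_log_of_three_le hn
    set m : ℝ := ((k + 1 : ℕ) : ℝ) with hm
    have e : m * (1 + 1 / m) ^ (k + 1 - 1) * (1 - m * Real.log (1 / m)) -
        (1 + 1 / m) ^ (k + 1) * (m * (1 / m)⁻¹) = m * m * (1 + 1 / m) ^ k * (Real.log m - 1) := by
      rw [Nat.add_sub_cancel, one_div, Real.log_inv, inv_inv, pow_succ]
      field_simp
      ring
    rw [e]
    have : 0 < Real.log m - 1 := by linarith
    positivity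
  have hslope := (hasDerivAt_iff_tendsto_slope_left_right.1 hd).1
  have hev := (hslope.eventually (lt_mem_nhds hd0)).and (Ioo_mem_nhdsLT hpos)
  obtain ⟨x, hx, hx0⟩ := hev.exists
  refine ⟨x, hx0, ?_⟩
  rw [slope_def_field] at hx
  have h1 : x - 1 / (n : ℝ) < 0 := by linarith [hx0.2]
  by_contra hcon
  push Not at hcon
  have : (rogersFun n x - rogersFun n (1 / n)) / (x - 1 / n) ≤ 0 :=
    div_nonpos_of_nonneg_of_nonpos (by linarith) h1.le
  linarith

theorem one_sub_mul_log_le_rogersFun (n : ℕ) {x : ℝ} (h0 : 0 < x) (h1 : x ≤ 1) :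
    1 - n * Real.log x ≤ rogersFun n x := by
  have hl := Real.log_nonpos h0.le h1
  have hA : 1 ≤ (1 + x) ^ n := one_le_pow₀ (by linarith)
  have hB : 0 ≤ 1 - n * Real.log x := by
    have : (0 : ℝ) ≤ n := by positivity
    nlinarith
  rw [rogersFun]
  nlinarith

theorem isLeast_rogersConst {n : ℕ} (hn : 3 ≤ n) :
    IsLeast (rogersFun n '' Ioo 0 (1 / (n : ℝ))) (rogersConst n) := by
  have h3 : (3 : ℝ) ≤ n := by exact_mod_cast hn
  have hn0 : (0 : ℝ) < n := by linarith
  have hle1 : 1 / (n : ℝ) ≤ 1 := by rw [div_le_one hn0]; linarith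
  obtain ⟨p, hp, hpn⟩ := exists_rogersFun_lt hn
  have hlarge : Tendsto (fun x : ℝ => 1 - n * Real.log x) (𝓝[>] 0) atTop :=
    tendsto_atTop_add_const_left _ 1
      (tendsto_neg_atBot_atTop.comp (Real.tendsto_log_nhdsGT_zero.const_mul_atBot hn0))
  obtain ⟨a, ha, haf⟩ : ∃ a, 0 < a ∧ ∀ x ∈ Ioo 0 a, rogersFun n p < 1 - n * Real.log x := by
    obtain ⟨a, ha, h⟩ := mem_nhdsGT_iff_exists_Ioo_subset.1
      (hlarge.eventually (eventually_gt_atTop (rogersFun n p)))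
    exact ⟨a, ha, fun x hx => h hx⟩
  -- To the left of `a` the function exceeds its value at `p`, so minimising over the compact
  -- interval from `b` to `1 / n` suffices.
  set b := min a p with hb
  have hb0 : 0 < b := lt_min ha hp.1
  have hcont : ContinuousOn (rogersFun n) (Icc b (1 / n)) := fun x hx =>
    (hasDerivAt_rogersFun n (hb0.trans_le hx.1).ne').continuousAt.continuousWithinAt
  have hpI : p ∈ Icc b (1 / (n : ℝ)) := ⟨min_le_right _ _, hp.2.le⟩
  obtain ⟨y, hy, hmin⟩ := isCompact_Icc.exists_isMinOn ⟨p, hpI⟩ hcont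
  have hyp : rogersFun n y ≤ rogersFun n p := hmin hpI
  have hy1 : y < 1 / n := by
    refine lt_of_le_of_ne hy.2 fun h => ?_
    rw [h] at hyp
    linarith
  have hL : IsLeast (rogersFun n '' Ioo 0 (1 / (n : ℝ))) (rogersFun n y) := by
    refine ⟨⟨y, ⟨hb0.trans_le hy.1, hy1⟩, rfl⟩, ?_⟩
    rintro _ ⟨x, hx, rfl⟩
    rcases le_or_gt b x with hbx | hbx
    · exact hmin ⟨hbx, hx.2.le⟩
    · have h1 := haf x ⟨hx.1, hbx.trans_le (min_le_left _ _)⟩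
      have h2 := one_sub_mul_log_le_rogersFun n hx.1 (hx.2.le.trans hle1)
      linarith
  rwa [rogersConst, hL.csInf_eq]

theorem rogersConst_le {n : ℕ} (hn : 3 ≤ n) {x l : ℝ} (h0 : 0 < x) (h1 : x < 1 / n)
    (hl : -Real.log x ≤ l) : rogersConst n ≤ (1 + x) ^ n * (1 + n * l) := by
  refine ((isLeast_rogersConst hn).2 ⟨x, ⟨h0, h1⟩, rfl⟩).trans ?_
  rw [rogersFun]
  have : (0 : ℝ) ≤ n := by positivity
  gcongr
  nlinarith

/-- An upper bound for `-log x` when `1 / x` is slightly larger than `2 ^ a * 3 ^ b * 5 ^ c`. -/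
theorem neg_log_le (a b c : ℕ) {x y : ℝ} (hy0 : 0 ≤ y) (hy1 : y < 1)
    (h : x = (2 ^ a * 3 ^ b * 5 ^ c * ((1 + y) / (1 - y)))⁻¹) :
    -Real.log x ≤ a * 0.6931471808 + b * 1.0986122888 + c * 1.6094379126
      + 2 * (y + y ^ 3 / 3 + y ^ 5 / 5 + y ^ 7 / (1 - y ^ 2)) := by
  have hy : 0 < (1 + y) / (1 - y) := div_pos (by linarith) (by linarith)
  -- Three terms of the series `log ((1 + y) / (1 - y)) = 2 (y + y ^ 3 / 3 + ...)` with a geometric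
  -- tail bound.
  have hlog := Real.log_div_le_sum_range_add hy0 hy1 3
  simp only [Finset.sum_range_succ, Finset.sum_range_zero] at hlog
  norm_num at hlog
  rw [h, Real.log_inv, neg_neg, Real.log_mul (by positivity) hy.ne',
    Real.log_mul (by positivity) (by positivity), Real.log_mul (by positivity) (by positivity),
    Real.log_pow, Real.log_pow, Real.log_pow]
  have h2 := Real.log_two_lt_d9.le
  have h3 := Real.log_three_lt_d9.le
  have h5 := Real.log_five_lt_d9.le
  have ha := mul_le_mul_of_nonneg_left h2 (Nat.cast_nonneg (α := ℝ) a)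
  have hb := mul_le_mul_of_nonneg_left h3 (Nat.cast_nonneg (α := ℝ) b)
  have hc := mul_le_mul_of_nonneg_left h5 (Nat.cast_nonneg (α := ℝ) c)
  linarith

end RogersConst

/-! ### Numerical upper bounds -/

section Numerics

/-- Here and below, `x` is a rational test point in `(0, 1 / n)`, and `y = (q - 1) / (q + 1)` where
`q` is `1 / x` divided by the chosen product of powers of 2, 3 and 5. The numerator is one more than
the claimed integer bound. -/
theorem rogersConst_7_lt : rogersConst 7 < 3955 / 2 ^ 7 := by
  have hl := neg_log_le 1 2 0 (x := 2 / 43) (y := 7 / 79)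
    (by norm_num) (by norm_num) (by norm_num)
  refine (rogersConst_le (by norm_num) (by norm_num) (by norm_num) hl).trans_lt ?_
  norm_num

theorem rogersConst_8_lt : rogersConst 8 < 9371 / 2 ^ 8 := by
  have hl := neg_log_le 0 0 2 (x := 1 / 26) (y := 1 / 51)
    (by norm_num) (by norm_num) (by norm_num)
  refine (rogersConst_le (by norm_num) (by norm_num) (by norm_num) hl).trans_lt ?_
  norm_num

theorem rogersConst_9_lt : rogersConst 9 < 2064333 / 48620 := by
  have hl := neg_log_le 0 3 0 (x := 5 / 154) (y := 19 / 289)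
    (by norm_num) (by norm_num) (by norm_num)
  refine (rogersConst_le (by norm_num) (by norm_num) (by norm_num) hl).trans_lt ?_
  norm_num

theorem rogersConst_10_lt : rogersConst 10 < 8950600 / 184756 := by
  have hl := neg_log_le 1 1 1 (x := 4 / 143) (y := 23 / 263)
    (by norm_num) (by norm_num) (by norm_num)
  refine (rogersConst_le (by norm_num) (by norm_num) (by norm_num) hl).trans_lt ?_
  norm_num

theorem rogersConst_11_lt : rogersConst 11 < 38482395 / 705432 := by
  have hl := neg_log_le 2 2 0 (x := 4 / 163) (y := 19 / 307)
    (by norm_num) (by norm_num) (by norm_num)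
  refine (rogersConst_le (by norm_num) (by norm_num) (by norm_num) hl).trans_lt ?_
  norm_num

theorem rogersConst_12_lt : rogersConst 12 < 164319570 / 2704156 := by
  have hl := neg_log_le 0 2 1 (x := 8 / 367) (y := 7 / 727)
    (by norm_num) (by norm_num) (by norm_num)
  refine (rogersConst_le (by norm_num) (by norm_num) (by norm_num) hl).trans_lt ?_
  norm_num

theorem rogersConst_13_lt : rogersConst 13 < 697656133 / 10400600 := by
  have hl := neg_log_le 0 2 1 (x := 6 / 307) (y := 37 / 577)
    (by norm_num) (by norm_num) (by norm_num)
  refine (rogersConst_le (by norm_num) (by norm_num) (by norm_num) hl).trans_lt ?_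
  norm_num

theorem rogersConst_14_lt : rogersConst 14 < 2947865483 / 40116600 := by
  have hl := neg_log_le 1 0 2 (x := 11 / 621) (y := 71 / 1171)
    (by norm_num) (by norm_num) (by norm_num)
  refine (rogersConst_le (by norm_num) (by norm_num) (by norm_num) hl).trans_lt ?_
  norm_num

end Numerics

/-! ### Bounds for the covering numbers -/

section Hadwiger
open scoped Pointwise
variable {n : ℕ}

theorem rogersConst_nonneg (hn : 3 ≤ n) : 0 ≤ rogersConst n := by
  obtain ⟨x, hx, e⟩ := (isLeast_rogersConst hn).1
  have h3 : (3 : ℝ) ≤ n := by exact_mod_cast hn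
  have hx1 : x ≤ 1 := hx.2.le.trans (by rw [div_le_one (by linarith)]; linarith)
  have := one_sub_mul_log_le_rogersFun n hx.1 hx1
  have := Real.log_nonpos hx.1.le hx1
  rw [← e]
  nlinarith

/-- The number of translates of the interior needed to cover a convex body, in terms of the
volume of the difference body. -/
theorem coveringNum_interior_le_floor (hn : 3 ≤ n) {K : ConvexBody (E n)} (hK : K ∈ bodies n)
    {q : ℝ} (hq : volume.real ((K : Set (E n)) - (K : Set (E n))) ≤ q * volume.real (K : Set (E n))) :
    coveringNum (K : Set (E n)) (interior (K : Set (E n))) ≤ ⌊q * rogersConst n⌋₊ := by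
  obtain ⟨x, hx, e⟩ := (isLeast_rogersConst hn).1
  obtain ⟨N, hN, hN'⟩ := exists_covering_interior (by omega) K.convex K.isCompact hK hx.1 hx.2.le
  refine (iInf₂_le N hN).trans (Nat.cast_le.2 (Nat.le_floor (hN'.trans ?_)))
  have hv : 0 < volume.real (K : Set (E n)) :=
    ENNReal.toReal_pos (Measure.measure_pos_of_nonempty_interior _ hK).ne'
      K.isCompact.measure_lt_top.ne
  rw [e, mul_comm]
  exact mul_le_mul_of_nonneg_right ((div_le_iff₀ hv).2 hq) (rogersConst_nonneg hn)

theorem hadwigerNum_le_floor (hn : 3 ≤ n) :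
    hadwigerNum n ≤ ⌊((2 * n).choose n : ℝ) * rogersConst n⌋₊ :=
  iSup₂_le fun K hK => coveringNum_interior_le_floor hn hK
    (volume_sub_self_le (by omega) K.convex K.isCompact
      (ENNReal.toReal_pos (Measure.measure_pos_of_nonempty_interior _ hK).ne'
        K.isCompact.measure_lt_top.ne))

theorem hadwigerNumSymm_le_floor (hn : 3 ≤ n) :
    hadwigerNumSymm n ≤ ⌊(2 : ℝ) ^ n * rogersConst n⌋₊ :=
  iSup₂_le fun K hK => by
    obtain ⟨hKb, c, hc⟩ := hK
    exact coveringNum_interior_le_floor hn hKb (volume_sub_self_of_symm K.convex hc).le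

theorem toENNReal_le_ofReal_of_le_floor {a : ℕ∞} {x : ℝ} (hx : 0 ≤ x) (h : a ≤ ⌊x⌋₊) :
    (a : ℝ≥0∞) ≤ ENNReal.ofReal x := by
  calc (a : ℝ≥0∞) ≤ ((⌊x⌋₊ : ℕ∞) : ℝ≥0∞) := ENat.toENNReal_le.2 h
    _ = ENNReal.ofReal (⌊x⌋₊ : ℝ) := by simp
    _ ≤ ENNReal.ofReal x := ENNReal.ofReal_le_ofReal (Nat.floor_le hx)

/-- The strict `r < s` forces `q * r < m + 1`, so the floor is at most `m`. -/
theorem le_of_le_floor_mul {a : ℕ∞} {q r s : ℝ} {m : ℕ} (h : a ≤ ⌊q * r⌋₊) (hq : 0 < q)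
    (hr : r < s) (hm : q * s ≤ m + 1) : a ≤ m := by
  refine h.trans (Nat.cast_le.2 (Nat.lt_succ_iff.1 (Nat.floor_lt' (by omega) |>.2 ?_)))
  push_cast
  exact (mul_lt_mul_of_pos_left hr hq).trans_le hm

end Hadwiger
end ConvexCovering

theorem mainTheorem2 :
    (∀ n : ℕ, 3 ≤ n →
      -- the minimum defining `r_n` is attained
      IsLeast (ConvexCovering.rogersFun n '' Ioo 0 (1 / (n : ℝ))) (ConvexCovering.rogersConst n) ∧
      -- the limit defining the covering density exists, and it is at most `r_n`
      (∀ K ∈ ConvexCovering.bodies n,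
        Tendsto (fun R : ℝ => ConvexCovering.cubeDensity (K : Set (ConvexCovering.E n)) R) atTop
          (𝓝 (ConvexCovering.coveringDensity (K : Set (ConvexCovering.E n)))) ∧
        ConvexCovering.coveringDensity (K : Set (ConvexCovering.E n))
          ≤ ConvexCovering.rogersConst n) ∧
      (ConvexCovering.hadwigerNum n : ℝ≥0∞)
        ≤ ENNReal.ofReal (((2 * n).choose n : ℝ) * ConvexCovering.rogersConst n) ∧
      (ConvexCovering.hadwigerNumSymm n : ℝ≥0∞)
        ≤ ENNReal.ofReal ((2 : ℝ) ^ n * ConvexCovering.rogersConst n)) ∧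
    (ConvexCovering.hadwigerNum 9 ≤ 2064332 ∧
      ConvexCovering.hadwigerNum 10 ≤ 8950599 ∧
      ConvexCovering.hadwigerNum 11 ≤ 38482394 ∧
      ConvexCovering.hadwigerNum 12 ≤ 164319569 ∧
      ConvexCovering.hadwigerNum 13 ≤ 697656132 ∧
      ConvexCovering.hadwigerNum 14 ≤ 2947865482) ∧
    (ConvexCovering.hadwigerNumSymm 7 ≤ 3954 ∧
      ConvexCovering.hadwigerNumSymm 8 ≤ 9370 ∧
      ConvexCovering.hadwigerNumSymm 9 ≤ 21738 ∧
      ConvexCovering.hadwigerNumSymm 10 ≤ 49608 ∧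
      ConvexCovering.hadwigerNumSymm 11 ≤ 111721 ∧
      ConvexCovering.hadwigerNumSymm 12 ≤ 248895 ∧
      ConvexCovering.hadwigerNumSymm 13 ≤ 549506 ∧
      ConvexCovering.hadwigerNumSymm 14 ≤ 1203936) := by
  open ConvexCovering in
  refine ⟨fun n hn => ⟨isLeast_rogersConst hn, fun K hK => ⟨?_, ?_⟩, ?_, ?_⟩, ?_, ?_⟩
  · exact tendsto_cubeDensity_of_convex (by omega) K.convex K.isCompact hK
  · obtain ⟨x, hx, e⟩ := (isLeast_rogersConst hn).1
    rw [← e]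
    exact coveringDensity_le_rogersFun (by omega) K.convex K.isCompact hK hx.1 hx.2.le
  · exact toENNReal_le_ofReal_of_le_floor (mul_nonneg (by positivity) (rogersConst_nonneg hn))
      (hadwigerNum_le_floor hn)
  · exact toENNReal_le_ofReal_of_le_floor (mul_nonneg (by positivity) (rogersConst_nonneg hn))
      (hadwigerNumSymm_le_floor hn)

  · exact ⟨le_of_le_floor_mul (m := 2064332) (hadwigerNum_le_floor (by norm_num)) (by norm_num [Nat.choose])
      rogersConst_9_lt (by norm_num [Nat.choose]),
      le_of_le_floor_mul (m := 8950599) (hadwigerNum_le_floor (by norm_num)) (by norm_num [Nat.choose])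
      rogersConst_10_lt (by norm_num [Nat.choose]),
      le_of_le_floor_mul (m := 38482394) (hadwigerNum_le_floor (by norm_num)) (by norm_num [Nat.choose])
      rogersConst_11_lt (by norm_num [Nat.choose]),
      le_of_le_floor_mul (m := 164319569) (hadwigerNum_le_floor (by norm_num)) (by norm_num [Nat.choose])
      rogersConst_12_lt (by norm_num [Nat.choose]),
      le_of_le_floor_mul (m := 697656132) (hadwigerNum_le_floor (by norm_num)) (by norm_num [Nat.choose])
      rogersConst_13_lt (by norm_num [Nat.choose]),
      le_of_le_floor_mul (m := 2947865482) (hadwigerNum_le_floor (by norm_num)) (by norm_num [Nat.choose])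
      rogersConst_14_lt (by norm_num [Nat.choose])⟩
  · exact ⟨le_of_le_floor_mul (m := 3954) (hadwigerNumSymm_le_floor (by norm_num)) (by norm_num [Nat.choose])
      rogersConst_7_lt (by norm_num [Nat.choose]),
      le_of_le_floor_mul (m := 9370) (hadwigerNumSymm_le_floor (by norm_num)) (by norm_num [Nat.choose])
      rogersConst_8_lt (by norm_num [Nat.choose]),
      -- From dimension 9 on, the estimates of `rogersConst` made for general bodies are sharp
      -- enough for symmetric ones too.
      le_of_le_floor_mul (m := 21738) (hadwigerNumSymm_le_floor (by norm_num)) (by norm_num [Nat.choose])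
      rogersConst_9_lt (by norm_num [Nat.choose]),
      le_of_le_floor_mul (m := 49608) (hadwigerNumSymm_le_floor (by norm_num)) (by norm_num [Nat.choose])
      rogersConst_10_lt (by norm_num [Nat.choose]),
      le_of_le_floor_mul (m := 111721) (hadwigerNumSymm_le_floor (by norm_num)) (by norm_num [Nat.choose])
      rogersConst_11_lt (by norm_num [Nat.choose]),
      le_of_le_floor_mul (m := 248895) (hadwigerNumSymm_le_floor (by norm_num)) (by norm_num [Nat.choose])
      rogersConst_12_lt (by norm_num [Nat.choose]),
      le_of_le_floor_mul (m := 549506) (hadwigerNumSymm_le_floor (by norm_num)) (by norm_num [Nat.choose])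
      rogersConst_13_lt (by norm_num [Nat.choose]),
      le_of_le_floor_mul (m := 1203936) (hadwigerNumSymm_le_floor (by norm_num)) (by norm_num [Nat.choose])
      rogersConst_14_lt (by norm_num [Nat.choose])⟩
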